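/- For $d\in\mathbf{Q}^*$ let $E_d$ be the elliptic curve over $\mathbf{Q}$ given by $y^2+(d+1)xy+dy=x^3+dx^2$, with origin the point at infinity $O$; the point $(0,0)\in E_d(\mathbf{Q})$ has order $5$. Let $d_1,d_2\in\mathbf{Q}^*$ and $n\in\{1,2,3,4\}$, let $A=E_{d_1}\times E_{d_2}$, let $G\cong\mathbf{Z}/5\mathbf{Z}$ be the subgroup scheme of $A$ generated by the rational point $\big((0,0),[n](0,0)\big)$, and let $\varphi:A\to B=A/G$ be the quotient isogeny, an isogeny of abelian surfaces over $\mathbf{Q}$ of degree $5$. Let $\varphi_{\mathbf{R}}:A(\mathbf{R})\to B(\mathbf{R})$ be the induced homomorphism on real points. Then $\ker\varphi_{\mathbf{R}}\cong\mathbf{Z}/5\mathbf{Z}$ and $\operatorname{coker}\varphi_{\mathbf{R}}=0$, i.e. $\varphi_{\mathbf{R}}$ is surjective. -/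

import Mathlib

open CategoryTheory CategoryTheory.Limits AlgebraicGeometry
open scoped MonoidalCategory CartesianMonoidalCategory MonObj

noncomputable section

universe u

namespace FiveTorsion

/-! ### The projective Weierstrass curve as a scheme -/

section Curve

variable {k : Type u} [Field k]

/-- The homogeneous ideal generated by the homogeneous Weierstrass polynomial
`Y²Z + a₁XYZ + a₃YZ² - (X³ + a₂X²Z + a₄XZ² + a₆Z³)` in `k[X, Y, Z]`. -/
def weierstrassIdeal (W : WeierstrassCurve k) : Ideal (MvPolynomial (Fin 3) k) :=
  Ideal.span {W.toProjective.polynomial}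

/-- The homogeneous coordinate ring `k[X, Y, Z] / (F)` of a plane Weierstrass cubic. -/
abbrev CoordRing (W : WeierstrassCurve k) : Type u :=
  MvPolynomial (Fin 3) k ⧸ weierstrassIdeal W

/-- The degree `n` part of `k[X, Y, Z] / (F)`: the classes of the forms of degree `n`. -/
def grading (W : WeierstrassCurve k) (n : ℕ) : Submodule k (CoordRing W) :=
  (MvPolynomial.homogeneousSubmodule (Fin 3) k n).map
    (Ideal.Quotient.mkₐ k (weierstrassIdeal W)).toLinearMap

lemma isHomogeneous_polynomial (W : WeierstrassCurve k) :
    W.toProjective.polynomial.IsHomogeneous 3 := by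
  have hX (i : Fin 3) : (MvPolynomial.X i : MvPolynomial (Fin 3) k).IsHomogeneous 1 :=
    MvPolynomial.isHomogeneous_X _ _
  have hC (a : k) : (MvPolynomial.C a : MvPolynomial (Fin 3) k).IsHomogeneous 0 :=
    MvPolynomial.isHomogeneous_C _ _
  unfold WeierstrassCurve.Projective.polynomial
  refine ((((hX _).pow 2).mul (hX _)).add ((((hC _).mul (hX _)).mul (hX _)).mul (hX _)) |>.add
    (((hC _).mul (hX _)).mul ((hX _).pow 2))).sub
    (((((hX _).pow 3).add (((hC _).mul ((hX _).pow 2)).mul (hX _))).add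
    (((hC _).mul (hX _)).mul ((hX _).pow 2))).add ((hC _).mul ((hX _).pow 3)))

lemma mk_mem_grading (W : WeierstrassCurve k) {n : ℕ} {p : MvPolynomial (Fin 3) k}
    (hp : p.IsHomogeneous n) : Ideal.Quotient.mk (weierstrassIdeal W) p ∈ grading W n :=
  ⟨p, hp, rfl⟩

instance (W : WeierstrassCurve k) : SetLike.GradedMonoid (grading W) where
  one_mem := mk_mem_grading W (MvPolynomial.isHomogeneous_one _ _)
  mul_mem := by
    rintro i j _ _ ⟨p, hp, rfl⟩ ⟨q, hq, rfl⟩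
    exact ⟨p * q, MvPolynomial.IsHomogeneous.mul hp hq,
      map_mul (Ideal.Quotient.mk (weierstrassIdeal W)) p q⟩

/-- Reduction modulo the Weierstrass polynomial, on the forms of degree `i`. -/
def reduceForm (W : WeierstrassCurve k) (i : ℕ) :
    MvPolynomial.homogeneousSubmodule (Fin 3) k i →ₗ[k] DirectSum ℕ fun i => grading W i :=
  (DirectSum.lof k ℕ (fun i => grading W i) i).comp
    ((Ideal.Quotient.mkₐ k (weierstrassIdeal W)).toLinearMap.restrict
      fun _ hp => mk_mem_grading W hp)

/-- Reduction modulo the Weierstrass polynomial, on families of homogeneous polynomials. -/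
def reduceForms (W : WeierstrassCurve k) :
    (DirectSum ℕ fun i => MvPolynomial.homogeneousSubmodule (Fin 3) k i) →ₐ[k]
      DirectSum ℕ fun i => grading W i :=
  DirectSum.toAlgebra k (fun i => MvPolynomial.homogeneousSubmodule (Fin 3) k i)
    (reduceForm W)
    (by
      change DirectSum.of (fun i => grading W i) 0 _ = _
      rw [DirectSum.one_def]
      rfl)
    (by
      intro i j p q
      change DirectSum.of (fun i => grading W i) (i + j) _ =
        DirectSum.of (fun i => grading W i) i _ * DirectSum.of (fun i => grading W i) j _
      rw [DirectSum.of_mul_of]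
      congr 1)

lemma reduceForms_of (W : WeierstrassCurve k) {n : ℕ} {p : MvPolynomial (Fin 3) k}
    (hp : p.IsHomogeneous n) :
    reduceForms W (DirectSum.of (fun i => MvPolynomial.homogeneousSubmodule (Fin 3) k i) n
      ⟨p, hp⟩) = DirectSum.of (fun i => grading W i) n ⟨_, mk_mem_grading W hp⟩ :=
  DirectSum.toAddMonoid_of (fun i => (reduceForm W i).toAddMonoidHom) n ⟨p, hp⟩

attribute [local instance] MvPolynomial.gradedAlgebra in
/-- The homogeneous components of a polynomial, reduced modulo the Weierstrass polynomial. -/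
def components (W : WeierstrassCurve k) :
    MvPolynomial (Fin 3) k →ₐ[k] DirectSum ℕ fun i => grading W i :=
  (reduceForms W).comp
    (DirectSum.decomposeAlgEquiv (MvPolynomial.homogeneousSubmodule (Fin 3) k)).toAlgHom

attribute [local instance] MvPolynomial.gradedAlgebra in
lemma components_of_isHomogeneous (W : WeierstrassCurve k) {n : ℕ} {p : MvPolynomial (Fin 3) k}
    (hp : p.IsHomogeneous n) :
    components W p = DirectSum.of (fun i => grading W i) n ⟨_, mk_mem_grading W hp⟩ := by
  have h : DirectSum.decompose (MvPolynomial.homogeneousSubmodule (Fin 3) k) p =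
      DirectSum.of (fun i => MvPolynomial.homogeneousSubmodule (Fin 3) k i) n ⟨p, hp⟩ :=
    DirectSum.decompose_of_mem _ hp
  rw [← reduceForms_of W hp, ← h]
  rfl

lemma components_eq_zero (W : WeierstrassCurve k) (p : MvPolynomial (Fin 3) k)
    (hp : p ∈ weierstrassIdeal W) : components W p = 0 := by
  obtain ⟨q, rfl⟩ := Ideal.mem_span_singleton.mp hp
  rw [map_mul, components_of_isHomogeneous W (isHomogeneous_polynomial W)]
  have : (⟨_, mk_mem_grading W (isHomogeneous_polynomial W)⟩ : grading W 3) = 0 :=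
    Subtype.ext (Ideal.Quotient.eq_zero_iff_mem.mpr (Ideal.mem_span_singleton_self _))
  rw [this, map_zero, zero_mul]

instance (W : WeierstrassCurve k) : GradedAlgebra (grading W) :=
  GradedAlgebra.ofAlgHom (grading W)
    (Ideal.Quotient.liftₐ (weierstrassIdeal W) (components W) (components_eq_zero W))
    (by
      refine Ideal.Quotient.algHom_ext _ (MvPolynomial.algHom_ext fun i => ?_)
      change DirectSum.coeAlgHom (grading W) (components W (MvPolynomial.X i)) = _
      rw [components_of_isHomogeneous W (MvPolynomial.isHomogeneous_X k i)]
      exact DirectSum.coeAlgHom_of (grading W) 1 _)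
    (by
      rintro i ⟨_, p, hp, rfl⟩
      exact components_of_isHomogeneous W hp)

/-- The plane projective cubic `Proj k[X, Y, Z] / (F)`, as a scheme over `k`. -/
def curve (W : WeierstrassCurve k) : Over (Spec (.of k)) :=
  Over.mk (Proj.toSpecZero (grading W) ≫
    Spec.map (CommRingCat.ofHom (algebraMap k (grading W 0))))

/-- Evaluation `k[X, Y, Z] / (F) → k` at a triple satisfying the equation. -/
def evalAt (W : WeierstrassCurve k) (P : Fin 3 → k) (hP : W.toProjective.Equation P) :
    CoordRing W →ₐ[k] k :=
  Ideal.Quotient.liftₐ (weierstrassIdeal W) (MvPolynomial.aeval P) (by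
    intro p hp
    obtain ⟨q, rfl⟩ := Ideal.mem_span_singleton.mp hp
    have h : MvPolynomial.eval P W.toProjective.polynomial = 0 := hP
    rw [map_mul, MvPolynomial.aeval_eq_eval, h, zero_mul])

/-- The `i`-th homogeneous coordinate, as an element of `k[X, Y, Z] / (F)`. -/
def coord (W : WeierstrassCurve k) (i : Fin 3) : CoordRing W :=
  Ideal.Quotient.mk (weierstrassIdeal W) (MvPolynomial.X i)

lemma coord_mem (W : WeierstrassCurve k) (i : Fin 3) : coord W i ∈ grading W 1 :=
  mk_mem_grading W (MvPolynomial.isHomogeneous_X k i)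

lemma evalAt_coord (W : WeierstrassCurve k) (P : Fin 3 → k) (hP : W.toProjective.Equation P)
    (i : Fin 3) : evalAt W P hP (coord W i) = P i := by
  simp [evalAt, coord]

lemma isUnit_evalAt_coord (W : WeierstrassCurve k) (P : Fin 3 → k)
    (hP : W.toProjective.Equation P) (i : Fin 3) (hi : P i ≠ 0) :
    IsUnit ((evalAt W P hP).toRingHom (coord W i)) :=
  (evalAt_coord W P hP i).symm ▸ hi.isUnit

/-- Evaluation at `P` of the fractions of degree `0` whose denominator is a power of the `i`-th
coordinate, for a triple `P` with `P i ≠ 0`. -/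
def evalAway (W : WeierstrassCurve k) (P : Fin 3 → k) (hP : W.toProjective.Equation P)
    (i : Fin 3) (hi : P i ≠ 0) :
    HomogeneousLocalization.Away (grading W) (coord W i) →+* k :=
  (IsLocalization.Away.lift (S := Localization.Away (coord W i)) (coord W i)
    (isUnit_evalAt_coord W P hP i hi)).comp
    (algebraMap (HomogeneousLocalization.Away (grading W) (coord W i))
      (Localization.Away (coord W i)))

/-- The `k`-rational point `[P 0 : P 1 : P 2]` of the projective Weierstrass curve, as a morphism
`Spec k ⟶ curve W` over `k` (through the standard chart where the `i`-th coordinate does not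
vanish). -/
def ratPoint (W : WeierstrassCurve k) (P : Fin 3 → k) (hP : W.toProjective.Equation P)
    (i : Fin 3) (hi : P i ≠ 0) : 𝟙_ (Over (Spec (.of k))) ⟶ curve W :=
  Over.homMk
    (Spec.map (CommRingCat.ofHom (evalAway W P hP i hi)) ≫
      Proj.awayι (grading W) (coord W i) (coord_mem W i) one_pos)
    (by
      have h : (evalAway W P hP i hi).comp ((HomogeneousLocalization.fromZeroRingHom (grading W)
          (.powers (coord W i))).comp (algebraMap k (grading W 0))) = RingHom.id k := by
        ext c
        change IsLocalization.Away.lift (coord W i)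
          (isUnit_evalAt_coord W P hP i hi) (algebraMap (CoordRing W)
          (Localization.Away (coord W i)) (algebraMap k (CoordRing W) c)) = c
        exact (IsLocalization.Away.lift_eq (coord W i) (isUnit_evalAt_coord W P hP i hi)
          (algebraMap k (CoordRing W) c)).trans ((evalAt W P hP).commutes c)
      change (Spec.map (CommRingCat.ofHom (evalAway W P hP i hi)) ≫
        Proj.awayι (grading W) (coord W i) (coord_mem W i) one_pos) ≫
        (Proj.toSpecZero (grading W) ≫
          Spec.map (CommRingCat.ofHom (algebraMap k (grading W 0)))) = 𝟙 _
      rw [Category.assoc, Proj.awayι_toSpecZero_assoc, ← Spec.map_comp, ← Spec.map_comp,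
        ← CommRingCat.ofHom_comp, ← CommRingCat.ofHom_comp, h, CommRingCat.ofHom_id, Spec.map_id])

end Curve

/-! ### The curves `E_d` with their points `O` and `(0, 0)` -/

section Family

/-- The Weierstrass equation `y² + (d + 1)xy + dy = x³ + dx²` over `ℚ`. -/
def weierstrass (d : ℚ) : WeierstrassCurve ℚ where
  a₁ := d + 1
  a₂ := d
  a₃ := d
  a₄ := 0
  a₆ := 0

/-- The projective curve `E_d` over `ℚ`. -/
def E (d : ℚ) : Over (Spec (.of ℚ)) :=
  curve (weierstrass d)

lemma equation_infinity (d : ℚ) : (weierstrass d).toProjective.Equation ![0, 1, 0] := by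
  simp [WeierstrassCurve.Projective.equation_iff, weierstrass]

lemma equation_origin (d : ℚ) : (weierstrass d).toProjective.Equation ![0, 0, 1] := by
  simp [WeierstrassCurve.Projective.equation_iff, weierstrass]

/-- The point at infinity `O = [0 : 1 : 0]` of `E_d`. -/
def infinity (d : ℚ) : 𝟙_ (Over (Spec (.of ℚ))) ⟶ E d :=
  ratPoint (weierstrass d) ![0, 1, 0] (equation_infinity d) 1 (by simp)

/-- The affine point `(0, 0) = [0 : 0 : 1]` of `E_d`. -/
def origin (d : ℚ) : 𝟙_ (Over (Spec (.of ℚ))) ⟶ E d :=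
  ratPoint (weierstrass d) ![0, 0, 1] (equation_origin d) 2 (by simp)

end Family

/-! ### Abelian varieties, quotients and rational points -/

section Groups

variable {k : Type u} [Field k]

/-- A group scheme over a field `k` is an abelian variety if it is proper, smooth and
geometrically integral over `k`. -/
structure IsAbelianVariety (B : Over (Spec (.of k))) [GrpObj B] : Prop where
  proper : IsProper B.hom
  smooth : Smooth B.hom
  geometricallyIntegral : GeometricallyIntegral B.hom

/-- The morphism from the constant scheme `ℤ/5ℤ` over `k` (five copies of `Spec k`) to a group
scheme `A` sending `i` to the `i`-th multiple of the rational point `P`. When `P` has order `5`,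
this is the inclusion of the subgroup scheme generated by `P`. (Groups of points are written
multiplicatively.) -/
def multiples {A : Over (Spec (.of k))} [GrpObj A] (P : 𝟙_ (Over (Spec (.of k))) ⟶ A) :
    (∐ fun _ : ZMod 5 => 𝟙_ (Over (Spec (.of k)))) ⟶ A :=
  Sigma.desc fun i => P ^ i.val

/-- The homomorphism `φ : A ⟶ B` of group schemes (of finite type over `k`) is the quotient of `A`
by the subgroup scheme `i : G ⟶ A`: it is faithfully flat, and its scheme-theoretic kernel, the
fibre product of `φ` with the unit section of `B`, is `i`. -/
structure IsQuotientBy {A B G : Over (Spec (.of k))} [GrpObj A] [GrpObj B]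
    (φ : A ⟶ B) [IsMonHom φ] (i : G ⟶ A) : Prop where
  flat : Flat φ.left
  surjective : Surjective φ.left
  kernel : IsPullback i (CartesianMonoidalCategory.toUnit G) φ η[B]

/-- `Spec L` as a scheme over `k`, for a field extension `L` of `k`; the `L`-rational points of
`X` are the morphisms `specOver k L ⟶ X` over `k`. -/
abbrev specOver (k : Type u) [Field k] (L : Type u) [Field L] [Algebra k L] :
    Over (Spec (.of k)) :=
  Over.mk (Spec.map (CommRingCat.ofHom (algebraMap k L)))

/-- The homomorphism `φ_L : A(L) → B(L)` induced by a homomorphism `φ : A ⟶ B` over `k`. -/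
abbrev onPoints {A B : Over (Spec (.of k))} [GrpObj A] [GrpObj B] (φ : A ⟶ B) [IsMonHom φ]
    (L : Type u) [Field L] [Algebra k L] : (specOver k L ⟶ A) →* (specOver k L ⟶ B) :=
  IsMonHom.monoidHom φ (specOver k L)

end Groups

end FiveTorsion
end

noncomputable section

universe v

namespace FiveTorsion

/-! ### Finiteness of the curves over the base field -/

section FiniteType

variable {k : Type u} [Field k]

/-! Over any extension field `L`, an `L`-point of the constant scheme `ℤ/5ℤ` is one of five rational
points, and the kernel inclusion is a monomorphism, so the kernel on `L`-points is exactly five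
distinct multiples of the generator `P` (`IsQuotientBy.card_ker`).

Surjectivity on real points is the vanishing of `H¹(Gal(ℂ/ℝ), ℤ/5ℤ)`, made explicit. A real point
`b` of `B` lifts to a complex point `a`, since `φ` is surjective and locally of finite type. With
`σ` complex conjugation, `g = σ(a) a⁻¹` lies in the kernel, whose points are rational, so `σ(g) =
g`; but also `σ(g) = g⁻¹`. Hence `g² = 1 = g⁵` and `g = 1`: the point `a` is real, and it maps to
`b`. -/

lemma algebraMap_grading_zero_surjective (W : WeierstrassCurve k) :
    Function.Surjective (algebraMap k (grading W 0)) := by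
  rintro ⟨_, p, hp, rfl⟩
  have h := MvPolynomial.totalDegree_eq_zero_iff_eq_C.mp
    (Nat.le_zero.mp (MvPolynomial.IsHomogeneous.totalDegree_le hp))
  exact ⟨MvPolynomial.coeff 0 p,
    Subtype.ext (congrArg (Ideal.Quotient.mk (weierstrassIdeal W)) h.symm)⟩

instance (W : WeierstrassCurve k) : Algebra.FiniteType (grading W 0) (CoordRing W) :=
  have : IsScalarTower k (grading W 0) (CoordRing W) :=
    .of_algebraMap_eq (R := k) (S := grading W 0) (A := CoordRing W) fun _ => rfl
  Algebra.FiniteType.of_restrictScalars_finiteType k _ _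

lemma locallyOfFiniteType_curve (W : WeierstrassCurve k) : LocallyOfFiniteType (curve W).hom := by
  have : LocallyOfFiniteType (Spec.map (CommRingCat.ofHom (algebraMap k (grading W 0)))) :=
    (HasRingHomProperty.Spec_iff (P := @LocallyOfFiniteType)).mpr
      (RingHom.FiniteType.of_surjective _ (algebraMap_grading_zero_surjective W))
  exact locallyOfFiniteType_comp (Proj.toSpecZero (grading W)) _

lemma locallyOfFiniteType_tensor_hom {S : Scheme.{u}} (X Y : Over S) [LocallyOfFiniteType X.hom]
    [LocallyOfFiniteType Y.hom] : LocallyOfFiniteType (X ⊗ Y).hom := by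
  rw [Over.tensorObj_hom]
  infer_instance

end FiniteType

/-! ### Field-valued points of constant schemes -/

section Coproduct

variable {k : Type u} [Field k] {σ : Type v} [Small.{u} σ]

section

variable {S : Scheme.{u}} (X : σ → Over S)

/-- The scheme underlying a coproduct of schemes over `S` is the coproduct of the underlying
schemes. -/
def sigmaLeftIso : (∐ fun i => (X i).left) ≅ (∐ X).left :=
  (PreservesCoproduct.iso (Over.forget S) X).symm

lemma sigma_ι_comp_sigmaLeftIso_hom (i : σ) :
    Sigma.ι (fun i => (X i).left) i ≫ (sigmaLeftIso X).hom = (Sigma.ι X i).left :=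
  ι_comp_sigmaComparison (Over.forget S) X i

instance (i : σ) : IsOpenImmersion (Sigma.ι X i).left := by
  rw [← sigma_ι_comp_sigmaLeftIso_hom]
  infer_instance

lemma exists_sigma_ι_left_eq (x : (∐ X).left) :
    ∃ (i : σ) (y : (X i).left), (Sigma.ι X i).left y = x := by
  obtain ⟨i, y, hy⟩ : ∃ (i : σ) (y : (X i).left),
      Sigma.ι (fun i => (X i).left) i y = (sigmaLeftIso X).inv x :=
    (sigmaOpenCover fun i => (X i).left).exists_eq _
  refine ⟨i, y, ?_⟩
  rw [← sigma_ι_comp_sigmaLeftIso_hom, Scheme.Hom.comp_apply, hy, ← Scheme.Hom.comp_apply,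
    Iso.inv_hom_id]
  rfl

lemma eq_of_sigma_ι_left_eq {i j : σ} {y : (X i).left} {z : (X j).left}
    (h : (Sigma.ι X i).left y = (Sigma.ι X j).left z) : i = j := by
  rw [← sigma_ι_comp_sigmaLeftIso_hom, ← sigma_ι_comp_sigmaLeftIso_hom, Scheme.Hom.comp_apply,
    Scheme.Hom.comp_apply] at h
  have h' := (sigmaLeftIso X).hom.isOpenEmbedding.injective h
  exact congrArg Sigma.fst ((sigmaι_eq_iff _ _ _ _ _).mp h')

end

/-- `Spec L` has a single point, so its image lies in one of the open copies of `Spec k`, and the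
morphism factors through that copy. -/
lemma exists_eq_toUnit_comp_ι {L : Type u} [Field L] [Algebra k L]
    (f : specOver k L ⟶ ∐ fun _ : σ => 𝟙_ (Over (Spec (.of k)))) :
    ∃ i, f = CartesianMonoidalCategory.toUnit (specOver k L) ≫
      Sigma.ι (fun _ : σ => 𝟙_ (Over (Spec (.of k)))) i := by
  let X := fun _ : σ => 𝟙_ (Over (Spec (.of k)))
  obtain ⟨i, y, hy⟩ := exists_sigma_ι_left_eq X (f.left (IsLocalRing.closedPoint L))
  have hr : Set.range f.left ⊆ Set.range (Sigma.ι X i).left := by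
    rintro _ ⟨x, rfl⟩
    obtain rfl : x = IsLocalRing.closedPoint L := Subsingleton.elim (α := PrimeSpectrum L) _ _
    exact ⟨y, hy⟩
  let g := IsOpenImmersion.lift (Sigma.ι X i).left f.left hr
  have hg : g ≫ (Sigma.ι X i).left = f.left := IsOpenImmersion.lift_fac _ _ _
  let g' : specOver k L ⟶ X i := Over.homMk g (by
    rw [← Over.w (Sigma.ι X i), reassoc_of% hg, Over.w f])
  refine ⟨i, ?_⟩
  rw [CartesianMonoidalCategory.toUnit_unique (CartesianMonoidalCategory.toUnit _) g']
  ext1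
  exact hg.symm

lemma toUnit_comp_ι_injective (L : Type u) [Field L] [Algebra k L] :
    Function.Injective fun i : σ => CartesianMonoidalCategory.toUnit (specOver k L) ≫
      Sigma.ι (fun _ : σ => 𝟙_ (Over (Spec (.of k)))) i := by
  intro i j h
  have h' := congr($(h).left (IsLocalRing.closedPoint L))
  exact eq_of_sigma_ι_left_eq _ h'

end Coproduct

/-! ### The kernel on points -/

section Kernel

variable {k : Type u} [Field k] {A B : Over (Spec (.of k))} [GrpObj A] [GrpObj B]
  {φ : A ⟶ B} [IsMonHom φ] {P : 𝟙_ (Over (Spec (.of k))) ⟶ A}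

lemma toUnit_ι_multiples (T : Over (Spec (.of k))) (i : ZMod 5) :
    (CartesianMonoidalCategory.toUnit T ≫
      Sigma.ι (fun _ : ZMod 5 => 𝟙_ (Over (Spec (.of k)))) i) ≫ multiples P =
      CartesianMonoidalCategory.toUnit T ≫ P ^ i.val := by
  simp [multiples]

/-- By the universal property of the fibre product, a point killed by `φ` factors through the
constant scheme. In particular every kernel point is already defined over `k`. -/
lemma IsQuotientBy.mem_ker_iff (hφ : IsQuotientBy φ (multiples P)) {L : Type u} [Field L]
    [Algebra k L] (a : specOver k L ⟶ A) : a ∈ (onPoints φ L).ker ↔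
      ∃ i : ZMod 5, CartesianMonoidalCategory.toUnit _ ≫ P ^ i.val = a := by
  have h1 : a ∈ (onPoints φ L).ker ↔
      a ≫ φ = CartesianMonoidalCategory.toUnit (specOver k L) ≫ η[B] := by
    rw [MonoidHom.mem_ker, ← Hom.one_def]
    rfl
  rw [h1]
  constructor
  · intro h
    obtain ⟨i, hi⟩ := exists_eq_toUnit_comp_ι (hφ.kernel.lift _ _ h)
    refine ⟨i, ?_⟩
    rw [← toUnit_ι_multiples, ← hi, hφ.kernel.lift_fst]
  · rintro ⟨i, rfl⟩
    rw [← toUnit_ι_multiples, Category.assoc, hφ.kernel.w, ← Category.assoc]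
    congr 1
    exact CartesianMonoidalCategory.toUnit_unique _ _

lemma IsQuotientBy.mono {G : Over (Spec (.of k))} {i : G ⟶ A} (hφ : IsQuotientBy φ i) :
    Mono i := by
  -- The structure morphism of `B` retracts the unit section; monomorphisms are stable under base
  -- change.
  have : IsSplitMono η[B] := ⟨⟨⟨CartesianMonoidalCategory.toUnit B,
    CartesianMonoidalCategory.toUnit_unique _ _⟩⟩⟩
  exact MorphismProperty.of_isPullback (P := .monomorphisms _) hφ.kernel.flip (.infer_property _)

/-- The kernel on `L`-points consists of the five multiples of `P`: being the base change of the
unit section, the inclusion of the scheme-theoretic kernel is a monomorphism. -/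
lemma IsQuotientBy.card_ker (hφ : IsQuotientBy φ (multiples P)) (L : Type u) [Field L]
    [Algebra k L] : Nat.card (onPoints φ L).ker = 5 := by
  have := hφ.mono
  have h : Function.Bijective fun i : ZMod 5 =>
      (⟨CartesianMonoidalCategory.toUnit _ ≫ P ^ i.val, (hφ.mem_ker_iff _).mpr ⟨i, rfl⟩⟩ :
        (onPoints φ L).ker) := by
    constructor
    · intro i j hij
      have h := congrArg Subtype.val hij
      simp only [← toUnit_ι_multiples, cancel_mono] at h
      exact toUnit_comp_ι_injective (k := k) L h
    · rintro ⟨a, ha⟩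
      obtain ⟨i, hi⟩ := (hφ.mem_ker_iff _).mp ha
      exact ⟨i, Subtype.ext hi⟩
  rw [← Nat.card_congr (Equiv.ofBijective _ h), Nat.card_zmod]

lemma IsQuotientBy.nonempty_ker_mulEquiv (hφ : IsQuotientBy φ (multiples P)) (L : Type u)
    [Field L] [Algebra k L] : Nonempty ((onPoints φ L).ker ≃* Multiplicative (ZMod 5)) :=
  have : Fact (Nat.Prime 5) := ⟨Nat.prime_five⟩
  ⟨mulEquivOfPrimeCardEq (p := 5) (hφ.card_ker L) (by simp)⟩

end Kernel

/-! ### Descent of points from `ℂ` to `ℝ`, and lifting over algebraically closed fields -/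

section Descent

/-- A complex point is a point `x` with an embedding of its residue field in `ℂ`; invariance under
conjugation forces the embedding to land in `ℝ`. -/
lemma exists_real_point {X : Scheme.{0}} (f : Spec (.of ℂ) ⟶ X)
    (hf : Spec.map (CommRingCat.ofHom (starRingEnd ℂ)) ≫ f = f) :
    ∃ g : Spec (.of ℝ) ⟶ X, Spec.map (CommRingCat.ofHom (algebraMap ℝ ℂ)) ≫ g = f := by
  obtain ⟨⟨x, a⟩, rfl⟩ := (Scheme.SpecToEquivOfField ℂ X).symm.surjective f
  simp only [Scheme.SpecToEquivOfField_symm_apply] at hf ⊢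
  rw [← Spec.map_comp_assoc, cancel_mono, Spec.map_inj] at hf
  have h (z : X.residueField x) : ((a.hom z).re : ℂ) = a.hom z :=
    Complex.conj_eq_iff_re.mp (congr(($hf).hom z))
  -- Taking real parts is multiplicative here because the values of `a` are real.
  let b : X.residueField x →+* ℝ :=
    { toFun z := (a.hom z).re
      map_one' := by simp
      map_zero' := by simp
      map_add' z w := by simp
      map_mul' z w := Complex.ofReal_injective (by rw [Complex.ofReal_mul, h, h, h, map_mul]) }
  refine ⟨Spec.map (CommRingCat.ofHom b) ≫ X.fromSpecResidueField x, ?_⟩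
  rw [← Spec.map_comp_assoc]
  congr 2
  ext z
  exact h z

/-- Nullstellensatz: the fibre over `y` is nonempty and locally of finite type over `K`, so it has a
closed point, which is `K`-rational. -/
lemma exists_algClosed_point {K : Type u} [Field K] [IsAlgClosed K] {X Y : Scheme.{u}}
    (f : X ⟶ Y) [LocallyOfFiniteType f] [Surjective f] (y : Spec (.of K) ⟶ Y) :
    ∃ x : Spec (.of K) ⟶ X, x ≫ f = y := by
  let p := pullback.snd f y
  have : JacobsonSpace ↥(pullback f y) := LocallyOfFiniteType.jacobsonSpace p
  obtain ⟨z, -⟩ := p.surjective (IsLocalRing.closedPoint K)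
  obtain ⟨x, -, hx⟩ := nonempty_inter_closedPoints (X := ↥(pullback f y))
    (Z := Set.univ) ⟨z, trivial⟩ isClosed_univ.isLocallyClosed
  refine ⟨pointOfClosedPoint p x hx ≫ pullback.fst f y, ?_⟩
  rw [Category.assoc, pullback.condition]
  exact pointOfClosedPoint_comp_assoc p x hx y

end Descent

/-! ### Surjectivity on real points -/

section RealPoints

/-- A field extension is faithfully flat. This allows equalities of real points to be checked over
`ℂ`. -/
lemma epi_SpecMap_of_field (K L : Type u) [Field K] [Field L] [Algebra K L] :
    Epi (Spec.map (CommRingCat.ofHom (algebraMap K L))) := by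
  have : Flat (Spec.map (CommRingCat.ofHom (algebraMap K L))) :=
    (HasRingHomProperty.Spec_iff (P := @Flat)).mpr
      ((RingHom.flat_algebraMap_iff (R := K) (S := L)).mpr inferInstance)
  have : Surjective (Spec.map (CommRingCat.ofHom (algebraMap K L))) :=
    ⟨fun x => ⟨IsLocalRing.closedPoint L, Subsingleton.elim (α := PrimeSpectrum K) _ _⟩⟩
  exact Flat.epi_of_flat_of_surjective _

lemma exists_complex_point {k : Type} [Field k] [Algebra k ℂ] {A B : Over (Spec (.of k))}
    (φ : A ⟶ B) [LocallyOfFiniteType A.hom]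
    [Surjective φ.left] (b : specOver k ℂ ⟶ B) : ∃ a : specOver k ℂ ⟶ A, a ≫ φ = b := by
  have : LocallyOfFiniteType (φ.left ≫ B.hom) := by rwa [Over.w φ]
  have := locallyOfFiniteType_of_comp φ.left B.hom
  obtain ⟨x, hx⟩ := exists_algClosed_point φ.left b.left
  refine ⟨Over.homMk x ?_, ?_⟩
  · rw [← Over.w φ, reassoc_of% hx, Over.w b]
  · ext1
    exact hx

variable {k : Type} [Field k] [Algebra k ℝ] [Algebra k ℂ] [IsScalarTower k ℝ ℂ]

variable (k) in
/-- The morphism `Spec ℂ ⟶ Spec ℝ` over `k`. -/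
def specComplexToReal : specOver k ℂ ⟶ specOver k ℝ :=
  Over.homMk (Spec.map (CommRingCat.ofHom (algebraMap ℝ ℂ))) (by
    dsimp
    rw [← Spec.map_comp, ← CommRingCat.ofHom_comp, ← IsScalarTower.algebraMap_eq])

variable (k) in
/-- Complex conjugation, as an endomorphism of `Spec ℂ` over `k`. -/
def specConj : specOver k ℂ ⟶ specOver k ℂ :=
  Over.homMk (Spec.map (CommRingCat.ofHom (starRingEnd ℂ))) (by
    dsimp
    rw [← Spec.map_comp, ← CommRingCat.ofHom_comp]
    congr 2
    ext x
    simp [IsScalarTower.algebraMap_apply k ℝ ℂ])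

lemma specConj_comp_specConj : specConj k ≫ specConj k = 𝟙 _ := by
  ext1
  change Spec.map _ ≫ Spec.map _ = 𝟙 _
  rw [← Spec.map_comp, ← Spec.map_id]
  congr 1
  ext x
  simp

lemma specConj_comp_specComplexToReal :
    specConj k ≫ specComplexToReal k = specComplexToReal k := by
  ext1
  change Spec.map _ ≫ Spec.map _ = Spec.map _
  rw [← Spec.map_comp]
  congr 1
  ext x
  simp

instance : Epi (specComplexToReal k) := by
  have : Epi ((Over.forget _).map (specComplexToReal k)) := epi_SpecMap_of_field ℝ ℂ
  exact (Over.forget _).epi_of_epi_map this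

lemma exists_specComplexToReal_comp_eq {X : Over (Spec (.of k))} (a : specOver k ℂ ⟶ X)
    (ha : specConj k ≫ a = a) : ∃ b : specOver k ℝ ⟶ X, specComplexToReal k ≫ b = a := by
  obtain ⟨g, hg⟩ := exists_real_point a.left congr(($ha).left)
  have := epi_SpecMap_of_field ℝ ℂ
  have h : g ≫ X.hom = (specOver k ℝ).hom := by
    rw [← cancel_epi (Spec.map (CommRingCat.ofHom (algebraMap ℝ ℂ))), reassoc_of% hg, Over.w a]
    exact (Over.w (specComplexToReal k)).symm
  refine ⟨Over.homMk g h, ?_⟩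
  ext1
  exact hg

variable {A B : Over (Spec (.of k))} [GrpObj A] [GrpObj B]
  {φ : A ⟶ B} [IsMonHom φ] {P : 𝟙_ (Over (Spec (.of k))) ⟶ A}

/-- If `φ` is the quotient by a constant subgroup of order `5`, then a complex point of `A` whose
image in `B` is real is itself real. -/
lemma IsQuotientBy.specConj_comp_eq (hφ : IsQuotientBy φ (multiples P)) (a : specOver k ℂ ⟶ A)
    (ha : specConj k ≫ a ≫ φ = a ≫ φ) : specConj k ≫ a = a := by
  let g : specOver k ℂ ⟶ A := (specConj k ≫ a) * a⁻¹
  have hg : g ∈ (onPoints φ ℂ).ker := by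
    rw [MonoidHom.mem_ker, map_mul, map_inv, mul_inv_eq_one]
    exact (Category.assoc _ _ _).trans ha
  -- Points of the kernel come from `k`-points, which conjugation fixes.
  have hconj : specConj k ≫ g = g := by
    obtain ⟨i, hi⟩ := (hφ.mem_ker_iff g).mp hg
    rw [← hi, ← Category.assoc]
    congr 1
    exact CartesianMonoidalCategory.toUnit_unique _ _
  -- Conjugation is an involution, so it exchanges the two factors of `g` up to inversion.
  have hinv : specConj k ≫ g = g⁻¹ := by
    rw [MonObj.comp_mul, GrpObj.comp_inv, ← Category.assoc, specConj_comp_specConj,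
      Category.id_comp, mul_inv_rev, inv_inv]
  have h5 : g ^ 5 = 1 := by
    have := pow_card_eq_one' (x := (⟨g, hg⟩ : (onPoints φ ℂ).ker))
    rw [hφ.card_ker ℂ] at this
    exact congrArg Subtype.val this
  have h2 : g * g = 1 := by
    nth_rw 1 [← hconj]
    rw [hinv, inv_mul_cancel]
  have h1 : g = 1 := by
    rwa [pow_succ, pow_succ, mul_assoc _ g g, h2, mul_one, pow_three', h2, one_mul] at h5
  exact mul_inv_eq_one.mp h1

lemma IsQuotientBy.surjective_onPoints_real (hφ : IsQuotientBy φ (multiples P))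
    [LocallyOfFiniteType A.hom] : Function.Surjective (onPoints φ ℝ) := by
  intro b
  have := hφ.surjective
  obtain ⟨a, ha⟩ := exists_complex_point φ (specComplexToReal k ≫ b)
  obtain ⟨a', rfl⟩ := exists_specComplexToReal_comp_eq a (hφ.specConj_comp_eq a (by
    rw [ha, ← Category.assoc, specConj_comp_specComplexToReal]))
  refine ⟨a', ?_⟩
  -- The image of `a'` and `b` agree over `ℂ`, hence over `ℝ`.
  rw [Category.assoc, cancel_epi] at ha
  exact ha

end RealPoints
end FiveTorsion
end
theorem mainTheorem10
    (d₁ d₂ : ℚ) (hd₁ : d₁ ≠ 0) (hd₂ : d₂ ≠ 0)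
    -- the group laws of the elliptic curves `E_{d₁}` and `E_{d₂}`, with origin `O`
    [GrpObj (FiveTorsion.E d₁)] [GrpObj (FiveTorsion.E d₂)]
    (hO₁ : η[FiveTorsion.E d₁] = FiveTorsion.infinity d₁)
    (hO₂ : η[FiveTorsion.E d₂] = FiveTorsion.infinity d₂)
    (n : ℕ) (hn : 1 ≤ n ∧ n ≤ 4)
    -- the quotient of `A = E_{d₁} × E_{d₂}` by the subgroup generated by `(0,0) × [n](0,0)`
    (B : Over (Spec (.of ℚ))) [GrpObj B] (hB : FiveTorsion.IsAbelianVariety B)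
    (φ : FiveTorsion.E d₁ ⊗ FiveTorsion.E d₂ ⟶ B) [IsMonHom φ]
    (hφ : FiveTorsion.IsQuotientBy φ (FiveTorsion.multiples
      (CartesianMonoidalCategory.lift (FiveTorsion.origin d₁) (FiveTorsion.origin d₂ ^ n)))) :
    Nonempty ((FiveTorsion.onPoints φ ℝ).ker ≃* Multiplicative (ZMod 5)) ∧
      Function.Surjective (FiveTorsion.onPoints φ ℝ) := by
  have := FiveTorsion.locallyOfFiniteType_curve (FiveTorsion.weierstrass d₁)
  have := FiveTorsion.locallyOfFiniteType_curve (FiveTorsion.weierstrass d₂)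
  have : LocallyOfFiniteType (FiveTorsion.E d₁ ⊗ FiveTorsion.E d₂).hom :=
    FiveTorsion.locallyOfFiniteType_tensor_hom (FiveTorsion.curve (FiveTorsion.weierstrass d₁))
      (FiveTorsion.curve (FiveTorsion.weierstrass d₂))
  exact ⟨hφ.nonempty_ker_mulEquiv ℝ, hφ.surjective_onPoints_real⟩
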